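/- Let $M,N\ge 0$ and let $\mathbb{C}^{M|N}$ be the $\mathbb{Z}_2$-graded space with basis $e_1,\dots,e_{M+N}$, of which $M$ vectors (the $sl(M)$ indices) satisfy $(-1)^{[i]}=\theta_0$ and the $N$ others (the $sl(N)$ indices) satisfy $(-1)^{[i]}=-\theta_0$, where $\theta_0=\pm1$; the two kinds of indices may be interleaved in any way. Let $E_{ij}$ be the elementary matrices, let $P_{12}=\sum_{i,j}(-1)^{[j]}E_{ij}\otimes E_{ji}$ be the super-permutation (graded tensor product), and let $R_{12}(\lambda)=\lambda\,\mathbb{I}+iP_{12}$. A matrix is bosonic if its only nonzero entries join indices of equal parity. Write $K_1=K\otimes\mathbb{I}$ and $K_2=\mathbb{I}\otimes K$. (1) Let $D\subseteq\mathbb{C}$ and let $K:D\to \mathrm{Mat}_{M+N}(\mathbb{C})$ take bosonic values, with $K(\lambda)$ invertible for infinitely many $\lambda\in D$. Suppose that for all $\lambda_1,\lambda_2\in D$ $$R_{12}(\lambda_1-\lambda_2)K_1(\lambda_1)R_{12}(\lambda_1+\lambda_2)K_2(\lambda_2)=K_2(\lambda_2)R_{12}(\lambda_1+\lambda_2)K_1(\lambda_1)R_{12}(\lambda_1-\lambda_2).$$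 Then there are $U\in GL(M)\times GL(N)$ (acting block-diagonally), $\xi\in\mathbb{C}$, a bosonic matrix $\mathbb{E}$, all independent of $\lambda$, and a scalar function $f$ such that $$K(\lambda)=f(\lambda)\,U\,(i\xi\,\mathbb{I}+\lambda\,\mathbb{E})\,U^{-1}$$ for all $\lambda\in D$, except possibly for $\lambda=0$ when $\xi=0$, and either (i) $\mathbb{E}$ is diagonal and $\mathbb{E}^2=\mathbb{I}$, or (ii) $\mathbb{E}$ is strictly (upper) triangular and $\mathbb{E}^2=0$. (2) Conversely, for all $U\in GL(M)\times GL(N)$, $\xi\in\mathbb{C}$, every scalar function $f$ on $\mathbb{C}$ and every bosonic $\mathbb{E}$ as in (i) or (ii), the function $f(\lambda)\,U(i\xi\,\mathbb{I}+\lambda\,\mathbb{E})U^{-1}$ is bosonic and satisfies the reflection equation for all $\lambda_1,\lambda_2\in\mathbb{C}$. -/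

import Mathlib

open Matrix

noncomputable section

namespace SuperReflection

/-- The index set of the standard basis of `ℂ^(M|N)`: `Sum.inl` lists the `M` indices of the
`sl(M)` part and `Sum.inr` the `N` indices of the `sl(N)` part. -/
abbrev Idx (M N : ℕ) : Type := Fin M ⊕ Fin N

/-- The parity `[i] ∈ {0, 1}`, determined by a sign `θ`: `(-1)^[i] = θ` for an `sl(M)` index and
`(-1)^[i] = -θ` for an `sl(N)` index. -/
def parity {M N : ℕ} (θ : ℤˣ) : Idx M N → ℕ
  | Sum.inl _ => if θ = 1 then 0 else 1
  | Sum.inr _ => if θ = 1 then 1 else 0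

/-- The graded tensor product `A ⊗ B` of two matrices, as a matrix acting on
`ℂ^(M|N) ⊗ ℂ^(M|N)`. It is the bilinear extension of the rule
`(A ⊗ B)(v ⊗ w) = (-1)^([B][v]) (A v) ⊗ (B w)` for homogeneous `B` and `v`; the elementary
matrix `E_kl` has parity `[k] + [l]`. -/
def gradedTensor {M N : ℕ} (θ : ℤˣ) (A B : Matrix (Idx M N) (Idx M N) ℂ) :
    Matrix (Idx M N × Idx M N) (Idx M N × Idx M N) ℂ :=
  Matrix.of fun p q =>
    (-1) ^ ((parity θ p.2 + parity θ q.2) * parity θ q.1) * A p.1 q.1 * B p.2 q.2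

/-- The super-permutation `P = ∑ i j, (-1)^[j] E_ij ⊗ E_ji`. -/
def superPerm (M N : ℕ) (θ : ℤˣ) :
    Matrix (Idx M N × Idx M N) (Idx M N × Idx M N) ℂ :=
  ∑ i : Idx M N, ∑ j : Idx M N,
    ((-1) ^ parity θ j : ℂ) • gradedTensor θ (Matrix.single i j 1) (Matrix.single j i 1)

/-- The rational `R`-matrix `R(z) = z 𝕀 + i P`. -/
def rMatrix (M N : ℕ) (θ : ℤˣ) (z : ℂ) :
    Matrix (Idx M N × Idx M N) (Idx M N × Idx M N) ℂ :=
  z • 1 + Complex.I • superPerm M N θ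

/-- `A₁ = A ⊗ 𝕀`. -/
def inFirst {M N : ℕ} (θ : ℤˣ) (A : Matrix (Idx M N) (Idx M N) ℂ) :
    Matrix (Idx M N × Idx M N) (Idx M N × Idx M N) ℂ :=
  gradedTensor θ A 1

/-- `A₂ = 𝕀 ⊗ A`. -/
def inSecond {M N : ℕ} (θ : ℤˣ) (A : Matrix (Idx M N) (Idx M N) ℂ) :
    Matrix (Idx M N × Idx M N) (Idx M N × Idx M N) ℂ :=
  gradedTensor θ 1 A

/-- A matrix is bosonic (even) if its nonzero entries join indices of equal parity. -/
def IsBosonic {M N : ℕ} (θ : ℤˣ) (A : Matrix (Idx M N) (Idx M N) ℂ) : Prop :=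
  ∀ i j, A i j ≠ 0 → parity θ i = parity θ j

/-- The soliton-preserving reflection equation for the values of `K` at all spectral parameters
in `D`. -/
def ReflectionEquation {M N : ℕ} (θ : ℤˣ) (D : Set ℂ)
    (K : ℂ → Matrix (Idx M N) (Idx M N) ℂ) : Prop :=
  ∀ x ∈ D, ∀ y ∈ D,
    rMatrix M N θ (x - y) * inFirst θ (K x) * rMatrix M N θ (x + y) * inSecond θ (K y) =
      inSecond θ (K y) * rMatrix M N θ (x + y) * inFirst θ (K x) * rMatrix M N θ (x - y)

/-- An element of `GL(M) × GL(N)` as a block-diagonal matrix. -/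
def blockGL {M N : ℕ} (U : GL (Fin M) ℂ × GL (Fin N) ℂ) : Matrix (Idx M N) (Idx M N) ℂ :=
  Matrix.fromBlocks (U.1 : Matrix (Fin M) (Fin M) ℂ) 0 0 (U.2 : Matrix (Fin N) (Fin N) ℂ)

/-- Strictly (upper) triangular, when the basis vectors are listed in the order `pos`. -/
def IsStrictlyTriangular {M N : ℕ} (pos : Idx M N ≃ Fin (M + N))
    (E : Matrix (Idx M N) (Idx M N) ℂ) : Prop :=
  ∀ i j, E i j ≠ 0 → pos i < pos j

/-- The admissible matrices `E`: bosonic, and either diagonal with `E² = 𝕀`, or strictly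
triangular with `E² = 0`. -/
def IsCanonical {M N : ℕ} (θ : ℤˣ) (pos : Idx M N ≃ Fin (M + N))
    (E : Matrix (Idx M N) (Idx M N) ℂ) : Prop :=
  IsBosonic θ E ∧ ((E.IsDiag ∧ E ^ 2 = 1) ∨ (IsStrictlyTriangular pos E ∧ E ^ 2 = 0))

/-- `U (i ξ 𝕀 + z E) U⁻¹`. -/
def canonicalK {M N : ℕ} (U : GL (Fin M) ℂ × GL (Fin N) ℂ) (ξ : ℂ)
    (E : Matrix (Idx M N) (Idx M N) ℂ) (z : ℂ) : Matrix (Idx M N) (Idx M N) ℂ :=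
  blockGL U * ((Complex.I * ξ) • 1 + z • E) * (blockGL U)⁻¹

end SuperReflection

end

/-! For bosonic `K` the grading signs survive only in `P`, and moving `P` to the right turns the
reflection equation into an identity between ordinary Kronecker products (`reflection_iff`). Adding
the identity with the two parameters exchanged forces `K x` and `K y` to commute; what is left is
the sign-free `TensorRelation`.

Fix a non-scalar invertible value `B = K w`. The relation makes each `K z` with `z ≠ -w` affine in
`B`, and substituting this back gives `B` a quadratic equation. Completing the square yields `E`
with `E²` equal to `0` or `1`, and the same quadratic fixes the ratio of the two coefficients of `K
z` (`exists_linear_form`). As `E` is affine in `K w` it is block diagonal, so each block is brought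
to canonical form separately (`exists_isCanonical_conj`). Conversely, a scalar `E²` is all the
relation needs (`tensorRelation_linear`). -/

namespace SuperReflection

open scoped Kronecker

/-! ### The sign-free tensor relation and its solutions -/

section Tensor

variable {ι : Type*} [DecidableEq ι]

theorem exists_eq_smul_one_of_kronecker {A : Matrix ι ι ℂ} (h : A ⊗ₖ 1 = 1 ⊗ₖ A) :
    ∃ m : ℂ, A = m • 1 := by
  rcases isEmpty_or_nonempty ι with hι | ⟨⟨k⟩⟩
  · exact ⟨0, Subsingleton.elim _ _⟩
  · refine ⟨A k k, ?_⟩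
    ext i j
    have := congrFun (congrFun h (i, k)) (j, k)
    simpa [kroneckerMap_apply, mul_comm] using this

theorem eq_zero_of_kronecker_add {A : Matrix ι ι ℂ} (h : A ⊗ₖ 1 + 1 ⊗ₖ A = 0) : A = 0 := by
  ext i j
  by_cases hij : i = j
  · subst hij
    have := congrFun (congrFun h (i, i)) (i, i)
    simpa [kroneckerMap_apply] using this
  · have := congrFun (congrFun h (i, i)) (j, i)
    simpa [kroneckerMap_apply, hij] using this

/-- Supplies a linear functional built from matrix entries that vanishes on `1` but not on `B`: a
difference of two entries, or one off-diagonal entry. -/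
theorem exists_witness_of_not_scalar {B : Matrix ι ι ℂ} (hB : ∀ m : ℂ, B ≠ m • 1) :
    ∃ k l k' l', B k l ≠ B k' l' ∧ (1 : Matrix ι ι ℂ) k l = (1 : Matrix ι ι ℂ) k' l' ∨
      k ≠ l ∧ B k l ≠ 0 := by
  by_contra! hcon
  rcases isEmpty_or_nonempty ι with hι | ⟨⟨k⟩⟩
  · exact hB 0 (Subsingleton.elim _ _)
  · refine hB (B k k) ?_
    ext i j
    by_cases hij : i = j
    · subst hij
      by_contra hne
      exact (hcon i i k k).1 (by simpa using hne) (by simp)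
    · simpa [hij] using (hcon i j k k).2 hij

theorem coeff_unique {B : Matrix ι ι ℂ} (hB : ∀ m : ℂ, B ≠ m • 1) {r s : ℂ}
    (h : r • B = s • (1 : Matrix ι ι ℂ)) : r = 0 := by
  by_contra hr
  refine hB (r⁻¹ * s) ?_
  rw [mul_smul, ← h, smul_smul, inv_mul_cancel₀ hr, one_smul]

variable [Fintype ι]

/-- The parameter-dependent relation to which the reflection equation reduces. -/
def TensorRelation (x y : ℂ) (A B : Matrix ι ι ℂ) : Prop :=
  A * B = B * A ∧
    (x + y) • (B ⊗ₖ A - A ⊗ₖ B) + (x - y) • ((A * B) ⊗ₖ 1 - 1 ⊗ₖ (A * B)) = 0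

theorem TensorRelation.apply {x y : ℂ} {A B : Matrix ι ι ℂ} (h : TensorRelation x y A B)
    (i j k l : ι) :
    (x + y) * (B i j * A k l - A i j * B k l) +
      (x - y) * ((A * B) i j * (1 : Matrix ι ι ℂ) k l - (1 : Matrix ι ι ℂ) i j * (A * B) k l)
        = 0 := by
  have := congrFun (congrFun h.2 (i, k)) (j, l)
  simpa [kroneckerMap_apply] using this

/-- Apply to the first tensor factor a functional `φ` with `φ 1 = 0` and `φ B ≠ 0`. The term `1 ⊗ A
B` dies, leaving `(x + y)(φ(B) A - φ(A) B) + (x - y) φ(A B) 1 = 0`, which is solved for `A`. -/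
theorem TensorRelation.exists_eq_add {x y : ℂ} {A B : Matrix ι ι ℂ}
    (h : TensorRelation x y A B) (hxy : x + y ≠ 0) (hB : ∀ m : ℂ, B ≠ m • 1) :
    ∃ α β : ℂ, A = α • 1 + β • B := by
  obtain ⟨k, l, k', l', ⟨hne, h1⟩ | ⟨hkl, hne⟩⟩ := exists_witness_of_not_scalar hB
  · have hd : B k l - B k' l' ≠ 0 := sub_ne_zero.mpr hne
    refine ⟨-((x - y) * ((A * B) k l - (A * B) k' l')) / ((x + y) * (B k l - B k' l')),
      (A k l - A k' l') / (B k l - B k' l'), ?_⟩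
    ext i j
    have e1 := h.apply k l i j
    have e2 := h.apply k' l' i j
    rw [h1] at e1
    simp only [Matrix.add_apply, Matrix.smul_apply, smul_eq_mul]
    field_simp
    linear_combination e1 - e2
  · refine ⟨-((x - y) * (A * B) k l) / ((x + y) * B k l), A k l / B k l, ?_⟩
    ext i j
    have e1 := h.apply k l i j
    rw [one_apply_ne hkl] at e1
    simp only [Matrix.add_apply, Matrix.smul_apply, smul_eq_mul]
    field_simp
    linear_combination e1

/-- The `B ⊗ B` terms cancel and the relation takes the form `Q ⊗ 1 = 1 ⊗ Q`, so `Q` is scalar; the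
factor `2 x` is `(x + y) + (x - y)`. -/
theorem TensorRelation.exists_quadratic {x y α β : ℂ} {B : Matrix ι ι ℂ}
    (h : TensorRelation x y (α • 1 + β • B) B) :
    ∃ m : ℂ, (2 * x * α) • B + ((x - y) * β) • (B * B) = m • 1 := by
  apply exists_eq_smul_one_of_kronecker
  ext ⟨i, k⟩ ⟨j, l⟩
  have e := h.apply i j k l
  simp only [add_mul, smul_mul_assoc, one_mul, Matrix.add_apply, Matrix.smul_apply, smul_eq_mul] at e
  simp only [kroneckerMap_apply, Matrix.add_apply, Matrix.smul_apply, smul_eq_mul]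
  linear_combination e

theorem TensorRelation.mul_scalar {x : ℂ} {A B : Matrix ι ι ℂ}
    (h : TensorRelation x (-x) A B) (hx : x ≠ 0) : ∃ m : ℂ, A * B = m • 1 := by
  apply exists_eq_smul_one_of_kronecker
  have := h.2
  rw [add_neg_cancel, zero_smul, zero_add, sub_neg_eq_add, smul_eq_zero] at this
  exact sub_eq_zero.mp (this.resolve_left fun h0 => hx (by linear_combination h0 / 2))

/-- If `B` is not scalar and `A` is related to it, then `A` is either non-scalar or zero. -/
theorem TensorRelation.eq_zero_of_scalar {x y α : ℂ} {B : Matrix ι ι ℂ}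
    (h : TensorRelation x y (α • 1) B) (hx : x ≠ 0) (hB : ∀ m : ℂ, B ≠ m • 1) : α = 0 := by
  by_contra hα
  obtain ⟨m, hm⟩ := TensorRelation.exists_quadratic (x := x) (y := y) (α := α) (β := 0) (B := B)
    (by simpa using h)
  have h2 : 2 * x * α ≠ 0 := mul_ne_zero (mul_ne_zero two_ne_zero hx) hα
  refine hB ((2 * x * α)⁻¹ * m) ?_
  rw [mul_smul, ← hm, mul_zero, zero_smul, add_zero, smul_smul, inv_mul_cancel₀ h2, one_smul]

theorem exists_sq_eq (μ : ℂ) : ∃ t : ℂ, t ≠ 0 ∧ (μ = 0 ∨ μ = t ^ 2) := by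
  by_cases h : μ = 0
  · exact ⟨1, one_ne_zero, Or.inl h⟩
  · obtain ⟨t, ht⟩ := IsAlgClosed.exists_pow_nat_eq μ (n := 2) (by norm_num)
    refine ⟨t, ?_, Or.inr ht.symm⟩
    rintro rfl
    exact h (by simpa using ht.symm)

/-- The solutions of the tensor relation, up to conjugation. -/
theorem exists_linear_form {D : Set ℂ} {K : ℂ → Matrix ι ι ℂ}
    (hinf : {z ∈ D | IsUnit (K z)}.Infinite)
    (hK : ∀ x ∈ D, ∀ y ∈ D, TensorRelation x y (K x) (K y)) :
    ∃ (c : ℂ) (E : Matrix ι ι ℂ) (f : ℂ → ℂ), (E ^ 2 = 0 ∨ E ^ 2 = 1) ∧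
      (∃ w ∈ D, ∃ r s : ℂ, E = r • 1 + s • K w) ∧
      ∀ z ∈ D, (z ≠ 0 ∨ c ≠ 0) → K z = f z • (c • 1 + z • E) := by
  suffices H : ∃ (c : ℂ) (E : Matrix ι ι ℂ), (E ^ 2 = 0 ∨ E ^ 2 = 1) ∧
      (∃ w ∈ D, ∃ r s : ℂ, E = r • 1 + s • K w) ∧
      ∀ z ∈ D, (z ≠ 0 ∨ c ≠ 0) → ∃ t : ℂ, K z = t • (c • 1 + z • E) by
    obtain ⟨c, E, h1, h2, h3⟩ := H
    choose! f hf using h3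
    exact ⟨c, E, f, h1, h2, hf⟩
  by_cases hsc : ∀ z ∈ D, z ≠ 0 → ∃ m : ℂ, K z = m • 1
  · obtain ⟨w, hw⟩ := hinf.nonempty
    refine ⟨0, 1, Or.inr (one_pow 2), ⟨w, hw.1, 1, 0, by simp⟩, fun z hz hz0 => ?_⟩
    have hz0 : z ≠ 0 := by simpa using hz0
    obtain ⟨m, hm⟩ := hsc z hz hz0
    exact ⟨m / z, by rw [hm, zero_smul, zero_add, smul_smul, div_mul_cancel₀ _ hz0]⟩
  push Not at hsc
  obtain ⟨v, hv, hv0, hvs⟩ := hsc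
  have hne : Nonempty ι := by
    by_contra hι
    rw [not_nonempty_iff] at hι
    exact hvs 0 (Subsingleton.elim _ _)
  obtain ⟨w, ⟨hw, hwu⟩, hwF⟩ := hinf.exists_notMem_finset {0, v, -v}
  simp only [Finset.mem_insert, Finset.mem_singleton, not_or] at hwF
  obtain ⟨hw0, -, hwv⟩ := hwF
  have hws : ∀ m : ℂ, K w ≠ m • 1 := by
    intro m hm
    have hrel := hK w hw v hv
    rw [hm] at hrel
    rw [hm, hrel.eq_zero_of_scalar hw0 hvs, zero_smul] at hwu
    exact not_isUnit_zero hwu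
  obtain ⟨u, ⟨hu, huu⟩, huF⟩ := hinf.exists_notMem_finset {0, w, -w}
  -- A second invertible value at `u ≠ 0, ±w` gives a nontrivial quadratic for `B`: both `u - w` and
  -- `β` are nonzero.
  simp only [Finset.mem_insert, Finset.mem_singleton, not_or] at huF
  obtain ⟨hu0, huw, huw'⟩ := huF
  set B := K w with hBdef
  obtain ⟨α, β, hαβ⟩ := (hK u hu w hw).exists_eq_add
    (fun h => huw' (eq_neg_of_add_eq_zero_left h)) hws
  have hrel := hK u hu w hw
  rw [hαβ] at hrel huu
  have hβ : β ≠ 0 := by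
    rintro rfl
    rw [zero_smul, add_zero] at hrel huu
    rw [hrel.eq_zero_of_scalar hu0 hws, zero_smul] at huu
    exact not_isUnit_zero huu
  obtain ⟨m, hm⟩ := hrel.exists_quadratic
  have huw0 : u - w ≠ 0 := sub_ne_zero.mpr huw
  -- `c` and `p` are read off from the quadratic, normalised as `B² = p + 2 c B`.
  obtain ⟨c, hc⟩ : ∃ c, c = -(u * α) / ((u - w) * β) := ⟨_, rfl⟩
  obtain ⟨p, hp⟩ : ∃ p, p = m / ((u - w) * β) := ⟨_, rfl⟩
  have hBB : B * B = p • 1 + (2 * c) • B := by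
    have hk : (u - w) * β ≠ 0 := mul_ne_zero huw0 hβ
    have : B * B = ((u - w) * β)⁻¹ • (m • 1 - (2 * u * α) • B) := by
      rw [← hm, add_sub_cancel_left, smul_smul, inv_mul_cancel₀ hk, one_smul]
    rw [this, smul_sub, smul_smul, smul_smul, hp, hc, sub_eq_add_neg, ← neg_smul]
    congr 2 <;> field_simp
  obtain ⟨t, ht0, ht⟩ := exists_sq_eq (p + c ^ 2)
  have hsq : (B - c • 1) * (B - c • 1) = (p + c ^ 2) • (1 : Matrix ι ι ℂ) := by
    simp only [sub_mul, mul_sub, hBB, smul_mul_assoc, mul_smul_comm, one_mul, mul_one]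
    module
  -- With `B = c + t E`, the constant `c w / t` is the one for which `B` itself is proportional to
  -- `c w / t + w E`.
  refine ⟨c * w / t, t⁻¹ • (B - c • 1), ?_, ⟨w, hw, -(t⁻¹ * c), t⁻¹, ?_⟩, fun z hz hzc => ?_⟩
  · rw [pow_two, smul_mul_smul_comm, hsq]
    rcases ht with ht | ht
    · left; rw [ht]; simp
    · right; rw [ht, smul_smul]
      field_simp
      simp
  · rw [hBdef]; module
  have hform : ∀ s : ℂ, s • ((c * w / t) • (1 : Matrix ι ι ℂ) + z • t⁻¹ • (B - c • 1)) =
      (s / t * c * (w - z)) • 1 + (s / t * z) • B := by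
    intro s
    have e1 : c * w / t = t⁻¹ * (c * w) := by ring
    rw [e1]
    module
  simp only [hform]
  -- At `z = -w` the affine form is unavailable. There `K z * B` is scalar, and `(2 c - B) B = -p`
  -- identifies `K z` as a multiple of `2 c - B`.
  by_cases hzw : z = -w
  · have hr := hK z hz w hw
    obtain ⟨n, hn⟩ := TensorRelation.mul_scalar (x := z) (A := K z) (B := B)
      (by rw [hzw, neg_neg, ← hzw]; exact hr) (by rw [hzw]; exact neg_ne_zero.mpr hw0)
    have hdet : (2 * c) • B - B * B = (-p) • 1 := by rw [hBB]; module
    have hp0 : p ≠ 0 := by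
      rintro rfl
      have h0 : B * (B - (2 * c) • 1) = 0 := by
        rw [mul_sub, hBB, mul_smul_comm, mul_one]; module
      rw [hwu.mul_right_eq_zero, sub_eq_zero] at h0
      exact hws _ h0
    refine ⟨-(n / p) * t / w, ?_⟩
    apply hwu.mul_left_injective
    have e : (-(n / p) * t / w / t * c * (w - -w)) • (1 : Matrix ι ι ℂ) +
        (-(n / p) * t / w / t * -w) • B = (-(n / p)) • ((2 * c) • 1 - B) := by
      have h1 : -(n / p) * t / w / t = -(n / p) * w⁻¹ := by field_simp
      have h2 : -(n / p) * w⁻¹ * c * (w - -w) = -(n / p) * (2 * c) := by field_simp; ring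
      have h3 : -(n / p) * w⁻¹ * -w = n / p := by field_simp
      rw [h1, h2, h3]
      module
    subst hzw
    simp only [e]
    rw [hn, smul_mul_assoc, sub_mul, smul_mul_assoc, one_mul, hdet, smul_smul]
    congr 1
    field_simp
  · obtain ⟨α', β', hz'⟩ := (hK z hz w hw).exists_eq_add
      (fun h => hzw (eq_neg_of_add_eq_zero_left h)) hws
    have hr := hK z hz w hw
    rw [hz'] at hr
    obtain ⟨n, hn⟩ := hr.exists_quadratic
    -- Reducing `B²` leaves an equation in `1` and `B`; since `B` is not scalar, its coefficient
    -- vanishes. This fixes the ratio `α' : β'`, except when `z = 0` and `c = 0`.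
    have hco : 2 * z * α' + (z - w) * β' * (2 * c) = 0 := by
      apply coeff_unique hws (s := n - (z - w) * β' * p)
      rw [← hBdef] at hn
      rw [hBB] at hn
      rw [sub_smul, ← hn]
      module
    rw [hz', ← hBdef]
    by_cases hz0 : z = 0
    · subst hz0
      have hc0 : c ≠ 0 := by
        rintro rfl; simp at hzc
      have hβ' : β' = 0 := by
        have : w * β' * c = 0 := by linear_combination -hco / 2
        simpa [hw0, hc0] using this
      refine ⟨α' * t / (c * w), ?_⟩
      rw [hβ']
      congr 2 <;> field_simp <;> simp
    · refine ⟨β' * t / z, ?_⟩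
      congr 2
      · field_simp
        linear_combination hco / 2
      · field_simp

end Tensor

/-! ### Reduction of the reflection equation to the tensor relation -/

section Reflection
variable {M N : ℕ} {θ : ℤˣ}

theorem superPerm_apply (p q : Idx M N × Idx M N) :
    superPerm M N θ p q =
      if p.1 = q.2 ∧ p.2 = q.1 then (-1) ^ (parity θ p.1 * parity θ p.2) else 0 := by
  obtain ⟨i, k⟩ := p
  obtain ⟨j, l⟩ := q
  have h : superPerm M N θ (i, k) (j, l) = ∑ a : Idx M N, ∑ b : Idx M N,
      if a = i ∧ b = j ∧ b = k ∧ a = l then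
        ((-1) ^ (parity θ i * parity θ k) : ℂ) else 0 := by
    rw [superPerm, Matrix.sum_apply]
    refine Finset.sum_congr rfl fun a _ => ?_
    rw [Matrix.sum_apply]
    refine Finset.sum_congr rfl fun b _ => ?_
    by_cases h : a = i ∧ b = j ∧ b = k ∧ a = l
    · obtain ⟨rfl, rfl, rfl, rfl⟩ := h
      simp only [gradedTensor, Matrix.smul_apply, Matrix.of_apply, single_apply_same, smul_eq_mul,
        mul_one, and_self, if_true]
      -- The weight `(-1)^[b]` cancels the sign `(-1)^([b][b])` from the graded tensor product,
      -- leaving `(-1)^([a][b])`.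
      rw [← pow_add, add_mul]
      have : Even (parity θ b + parity θ b * parity θ b) := by
        rw [show parity θ b + parity θ b * parity θ b = parity θ b * (parity θ b + 1) by ring]
        exact Nat.even_mul_succ_self _
      rw [← add_assoc, pow_add, this.neg_one_pow, one_mul]
    · rw [if_neg h]
      simp only [gradedTensor, Matrix.smul_apply, Matrix.of_apply, single_apply, smul_eq_mul]
      split_ifs <;> simp_all
  rw [h]
  by_cases hc : i = l ∧ k = j
  · obtain ⟨rfl, rfl⟩ := hc
    simp [and_self, ite_and]
  · rw [if_neg hc]
    refine Finset.sum_eq_zero fun a _ => Finset.sum_eq_zero fun b _ => if_neg ?_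
    rintro ⟨rfl, rfl, rfl, rfl⟩
    exact hc ⟨rfl, rfl⟩

theorem inFirst_eq (A : Matrix (Idx M N) (Idx M N) ℂ) : inFirst θ A = A ⊗ₖ 1 := by
  ext ⟨i, k⟩ ⟨j, l⟩
  by_cases h : k = l
  · subst h
    have : Even ((parity θ k + parity θ k) * parity θ j) := (Even.add_self _).mul_right _
    simp [inFirst, gradedTensor, kroneckerMap_apply, this.neg_one_pow]
  · simp [inFirst, gradedTensor, kroneckerMap_apply, h]

theorem inSecond_eq {A : Matrix (Idx M N) (Idx M N) ℂ} (hA : IsBosonic θ A) :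
    inSecond θ A = 1 ⊗ₖ A := by
  ext ⟨i, k⟩ ⟨j, l⟩
  by_cases h : A k l = 0
  · simp [inSecond, gradedTensor, kroneckerMap_apply, h]
  · have : Even ((parity θ k + parity θ l) * parity θ j) := by
      rw [hA k l h]
      exact (Even.add_self _).mul_right _
    simp [inSecond, gradedTensor, kroneckerMap_apply, this.neg_one_pow]

theorem superPerm_mul_apply (X : Matrix (Idx M N × Idx M N) (Idx M N × Idx M N) ℂ)
    (p q : Idx M N × Idx M N) :
    (superPerm M N θ * X) p q = (-1) ^ (parity θ p.1 * parity θ p.2) * X p.swap q := by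
  rw [mul_apply, Finset.sum_eq_single p.swap]
  · simp [superPerm_apply]
  · rintro r - hr
    rw [superPerm_apply, if_neg, zero_mul]
    rintro ⟨h1, h2⟩
    exact hr (Prod.ext h2.symm h1.symm)
  · simp

theorem mul_superPerm_apply (X : Matrix (Idx M N × Idx M N) (Idx M N × Idx M N) ℂ)
    (p q : Idx M N × Idx M N) :
    (X * superPerm M N θ) p q = (-1) ^ (parity θ q.1 * parity θ q.2) * X p q.swap := by
  rw [mul_apply, Finset.sum_eq_single q.swap]
  · simp [superPerm_apply, mul_comm]
  · rintro r - hr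
    rw [superPerm_apply, if_neg, mul_zero]
    rintro ⟨h1, h2⟩
    exact hr (Prod.ext h1 h2)
  · simp

theorem superPerm_mul_self : superPerm M N θ * superPerm M N θ = 1 := by
  ext p q
  rw [superPerm_mul_apply, superPerm_apply]
  by_cases h : p = q
  · subst h
    simp [mul_comm (parity θ p.2), ← pow_add, ← two_mul]
  · rw [if_neg, mul_zero, one_apply_ne h]
    rintro ⟨h1, h2⟩
    exact h (Prod.ext h2 h1)

theorem superPerm_mul_first {A : Matrix (Idx M N) (Idx M N) ℂ} (hA : IsBosonic θ A) :
    superPerm M N θ * (A ⊗ₖ 1) = (1 ⊗ₖ A) * superPerm M N θ := by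
  ext ⟨i, k⟩ ⟨j, l⟩
  rw [superPerm_mul_apply, mul_superPerm_apply]
  simp only [kroneckerMap_apply, Prod.swap_prod_mk]
  by_cases h : A k j = 0
  · simp [h]
  · by_cases hil : i = l
    · subst hil
      rw [hA k j h]
      simp [mul_comm]
    · simp [hil]

theorem superPerm_mul_second {A : Matrix (Idx M N) (Idx M N) ℂ} (hA : IsBosonic θ A) :
    superPerm M N θ * (1 ⊗ₖ A) = (A ⊗ₖ 1) * superPerm M N θ := by
  have h := congrArg (fun X => superPerm M N θ * X * superPerm M N θ) (superPerm_mul_first hA)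
  simp only [Matrix.mul_assoc, superPerm_mul_self, Matrix.mul_one] at h
  rw [← Matrix.mul_assoc, superPerm_mul_self, Matrix.one_mul] at h
  exact h.symm

/-- The reflection equation for a pair of bosonic values, with the permutations moved to the
right. -/
theorem reflection_iff {A B : Matrix (Idx M N) (Idx M N) ℂ} (hA : IsBosonic θ A)
    (hB : IsBosonic θ B) (a b : ℂ) :
    rMatrix M N θ a * inFirst θ A * rMatrix M N θ b * inSecond θ B =
      inSecond θ B * rMatrix M N θ b * inFirst θ A * rMatrix M N θ a ↔
    Complex.I • (b • (B ⊗ₖ A - A ⊗ₖ B) + a • ((A * B) ⊗ₖ 1 - 1 ⊗ₖ (B * A))) =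
      (1 ⊗ₖ (A * B - B * A)) * superPerm M N θ := by
  -- Since `P² = 1`, a factor `P` on the right can be transferred across the equation.
  have key : ∀ X Y : Matrix (Idx M N × Idx M N) (Idx M N × Idx M N) ℂ,
      X * superPerm M N θ = Y ↔ X = Y * superPerm M N θ := by
    intro X Y
    constructor
    · rintro rfl
      rw [Matrix.mul_assoc, superPerm_mul_self, Matrix.mul_one]
    · rintro rfl
      rw [Matrix.mul_assoc, superPerm_mul_self, Matrix.mul_one]
  rw [← key, inFirst_eq, inSecond_eq hB]
  have hA1 := superPerm_mul_first hA
  have hB2 := superPerm_mul_second hB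
  have hPP := superPerm_mul_self (M := M) (N := N) (θ := θ)
  have t1 : ∀ A B : Matrix (Idx M N) (Idx M N) ℂ, (A ⊗ₖ (1 : Matrix (Idx M N) (Idx M N) ℂ)) *
      ((1 : Matrix (Idx M N) (Idx M N) ℂ) ⊗ₖ B) = A ⊗ₖ B := by
    intro A B; rw [← mul_kronecker_mul]; simp
  have t2 : ∀ A B : Matrix (Idx M N) (Idx M N) ℂ, ((1 : Matrix (Idx M N) (Idx M N) ℂ) ⊗ₖ B) *
      (A ⊗ₖ (1 : Matrix (Idx M N) (Idx M N) ℂ)) = A ⊗ₖ B := by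
    intro A B; rw [← mul_kronecker_mul]; simp
  have t3 : ∀ A B : Matrix (Idx M N) (Idx M N) ℂ, ((1 : Matrix (Idx M N) (Idx M N) ℂ) ⊗ₖ A) *
      ((1 : Matrix (Idx M N) (Idx M N) ℂ) ⊗ₖ B) = 1 ⊗ₖ (A * B) := by
    intro A B; rw [← mul_kronecker_mul]; simp
  have t4 : ∀ A B : Matrix (Idx M N) (Idx M N) ℂ, (A ⊗ₖ (1 : Matrix (Idx M N) (Idx M N) ℂ)) *
      (B ⊗ₖ (1 : Matrix (Idx M N) (Idx M N) ℂ)) = (A * B) ⊗ₖ 1 := by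
    intro A B; rw [← mul_kronecker_mul]; simp
  have L : rMatrix M N θ a * (A ⊗ₖ 1) * rMatrix M N θ b * (1 ⊗ₖ B) =
      (a * b) • (A ⊗ₖ B) + (Complex.I * b) • (B ⊗ₖ A * superPerm M N θ) +
        (Complex.I * a) • ((A * B) ⊗ₖ 1 * superPerm M N θ) - 1 ⊗ₖ (A * B) := by
    simp only [rMatrix, add_mul, mul_add, smul_mul_assoc, mul_smul_comm, Matrix.one_mul,
      Matrix.mul_one, Matrix.mul_assoc, hA1, hB2, hPP, smul_smul, smul_add]
    simp only [← Matrix.mul_assoc, t1, t2, t3, t4, Complex.I_mul_I]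
    module
  have R : (1 ⊗ₖ B) * rMatrix M N θ b * (A ⊗ₖ 1) * rMatrix M N θ a =
      (a * b) • (A ⊗ₖ B) + (Complex.I * b) • (A ⊗ₖ B * superPerm M N θ) +
        (Complex.I * a) • (1 ⊗ₖ (B * A) * superPerm M N θ) - 1 ⊗ₖ (B * A) := by
    simp only [rMatrix, add_mul, mul_add, smul_mul_assoc, mul_smul_comm, Matrix.mul_one,
      Matrix.mul_assoc, hA1, hPP, smul_smul, smul_add]
    simp only [← Matrix.mul_assoc, t2, t3, Complex.I_mul_I]
    module
  have hs : (1 : Matrix (Idx M N) (Idx M N) ℂ) ⊗ₖ (A * B - B * A) =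
      1 ⊗ₖ (A * B) - 1 ⊗ₖ (B * A) := by
    ext ⟨i, k⟩ ⟨j, l⟩
    simp [kroneckerMap_apply, mul_sub]
  rw [L, R, hs]
  simp only [smul_mul_assoc, add_mul, sub_mul]
  rw [← sub_eq_zero, eq_comm, ← sub_eq_zero (a := Complex.I • _), eq_comm]
  refine Eq.congr ?_ rfl
  module

/-- In the sum of the two reduced equations everything cancels except `i (x - y) (C ⊗ 1 + 1 ⊗ C) =
0` with `C = A B - B A`. Hence `C = 0`, and the term containing `P` disappears. -/
theorem tensorRelation_of_reflection {A B : Matrix (Idx M N) (Idx M N) ℂ} {x y : ℂ}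
    (hA : IsBosonic θ A) (hB : IsBosonic θ B) (hxy : x = y → A = B)
    (h : rMatrix M N θ (x - y) * inFirst θ A * rMatrix M N θ (x + y) * inSecond θ B =
      inSecond θ B * rMatrix M N θ (x + y) * inFirst θ A * rMatrix M N θ (x - y))
    (h' : rMatrix M N θ (y - x) * inFirst θ B * rMatrix M N θ (y + x) * inSecond θ A =
      inSecond θ A * rMatrix M N θ (y + x) * inFirst θ B * rMatrix M N θ (y - x)) :
    TensorRelation x y A B := by
  rw [reflection_iff hA hB] at h
  rw [reflection_iff hB hA] at h'
  have hs : (A * B - B * A) ⊗ₖ (1 : Matrix (Idx M N) (Idx M N) ℂ) =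
      (A * B) ⊗ₖ 1 - (B * A) ⊗ₖ 1 := by
    ext ⟨i, k⟩ ⟨j, l⟩
    simp [kroneckerMap_apply, sub_mul]
  have hs' : ∀ A B : Matrix (Idx M N) (Idx M N) ℂ,
      (1 : Matrix (Idx M N) (Idx M N) ℂ) ⊗ₖ (A - B) = 1 ⊗ₖ A - 1 ⊗ₖ B := by
    intro A B
    ext ⟨i, k⟩ ⟨j, l⟩
    simp [kroneckerMap_apply, mul_sub]
  have hC : A * B - B * A = 0 := by
    by_cases hne : x = y
    · rw [hxy hne, sub_self]
    refine eq_zero_of_kronecker_add ?_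
    have hsum := congrArg₂ (· + ·) h h'
    have h0 : (Complex.I * (x - y)) • ((A * B - B * A) ⊗ₖ
        (1 : Matrix (Idx M N) (Idx M N) ℂ) + 1 ⊗ₖ (A * B - B * A)) = 0 := by
      rw [hs, hs']
      simp only [hs', sub_mul] at hsum
      rw [← sub_eq_zero] at hsum
      rw [← hsum]
      module
    exact (smul_eq_zero.mp h0).resolve_left (mul_ne_zero Complex.I_ne_zero
      (sub_ne_zero.mpr hne))
  rw [hC, kronecker_zero, Matrix.zero_mul, smul_eq_zero] at h
  have hAB := sub_eq_zero.mp hC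
  refine ⟨hAB, ?_⟩
  rw [← hAB] at h
  exact h.resolve_left Complex.I_ne_zero

theorem reflection_of_tensorRelation {A B : Matrix (Idx M N) (Idx M N) ℂ} {x y : ℂ}
    (hA : IsBosonic θ A) (hB : IsBosonic θ B) (h : TensorRelation x y A B) :
    rMatrix M N θ (x - y) * inFirst θ A * rMatrix M N θ (x + y) * inSecond θ B =
      inSecond θ B * rMatrix M N θ (x + y) * inFirst θ A * rMatrix M N θ (x - y) := by
  rw [reflection_iff hA hB, ← h.1, h.2, sub_self, smul_zero, kronecker_zero, Matrix.zero_mul]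

end Reflection

/-! ### Canonical forms of `E` under block-diagonal conjugation, and the converse -/

section CanonicalForm

/-- A basis adapted to a direct sum decomposition, in which the vectors of the first summand come
first in the order given by `p`. -/
theorem exists_adapted_basis {m n : ℕ} (p : Fin m → Fin n) (hp : Function.Injective p)
    {S T : Submodule ℂ (Fin m → ℂ)} (hST : IsCompl S T) :
    ∃ (b : Module.Basis (Fin m) ℂ (Fin m → ℂ)) (first : Fin m → Prop),
      (∀ i, first i → b i ∈ S) ∧ (∀ i, ¬ first i → b i ∈ T) ∧
      (∀ s ∈ S, ∀ i, ¬ first i → b.repr s i = 0) ∧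
      ∀ i j, first i → ¬ first j → p i < p j := by
  have hdim : Module.finrank ℂ S + Module.finrank ℂ T = m := by
    rw [Submodule.finrank_add_eq_of_isCompl hST, Module.finrank_fin_fun]
  let b₀ := ((Module.finBasis ℂ S).prod (Module.finBasis ℂ T)).map
    (Submodule.prodEquivOfIsCompl S T hST)
  -- `Tuple.sort p` lists the indices by increasing `p`; the basis of `S` takes the initial ones.
  let e : Fin (Module.finrank ℂ S) ⊕ Fin (Module.finrank ℂ T) ≃ Fin m :=
    (finSumFinEquiv.trans (finCongr hdim)).trans (Tuple.sort p)
  have he : ∀ k l, e (Sum.inl k) = Tuple.sort p (finCongr hdim (Fin.castAdd _ k)) ∧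
      e (Sum.inr l) = Tuple.sort p (finCongr hdim (Fin.natAdd _ l)) := by
    intro k l
    simp [e]
  refine ⟨b₀.reindex e, fun i => ∃ k, e (Sum.inl k) = i, ?_, ?_, ?_, ?_⟩
  · rintro _ ⟨k, rfl⟩
    simp [b₀]
  · intro i hi
    obtain ⟨k | l, rfl⟩ := e.surjective i
    · exact (hi ⟨k, rfl⟩).elim
    · simp [b₀]
  · intro s hs i hi
    obtain ⟨k | l, rfl⟩ := e.surjective i
    · exact (hi ⟨k, rfl⟩).elim
    · have : (Submodule.prodEquivOfIsCompl S T hST).symm s = ((⟨s, hs⟩ : S), (0 : T)) :=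
        Submodule.prodEquivOfIsCompl_symm_apply_left S T hST (⟨s, hs⟩ : S)
      simp [b₀, this]
  · rintro _ j ⟨k, rfl⟩ hj
    obtain ⟨k' | l, rfl⟩ := e.surjective j
    · exact (hj ⟨k', rfl⟩).elim
    · rw [(he k l).1, (he k l).2]
      refine lt_of_le_of_ne (Tuple.monotone_sort p ?_) ?_
      · rw [Fin.le_def]
        simp
        omega
      · intro h
        have h1 := congrArg Fin.val ((Tuple.sort p).injective (hp h))
        simp at h1
        omega

theorem exists_conj_of_basis {m : ℕ} (E : Matrix (Fin m) (Fin m) ℂ)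
    (b : Module.Basis (Fin m) ℂ (Fin m → ℂ)) :
    ∃ U : GL (Fin m) ℂ, E = U * Matrix.of (fun i j => b.repr (E *ᵥ b j) i) *
      (U⁻¹ : GL (Fin m) ℂ) := by
  let e := Pi.basisFun ℂ (Fin m)
  refine ⟨⟨e.toMatrix b, b.toMatrix e, Module.Basis.toMatrix_mul_toMatrix_flip _ _,
    Module.Basis.toMatrix_mul_toMatrix_flip _ _⟩, ?_⟩
  have h := basis_toMatrix_mul_linearMap_toMatrix_mul_basis_toMatrix e b e b (Matrix.toLin' E)
  have h1 : LinearMap.toMatrix b b (Matrix.toLin' E) =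
      Matrix.of (fun i j => b.repr (E *ᵥ b j) i) := by
    ext i j
    simp [LinearMap.toMatrix_apply]
  have h2 : LinearMap.toMatrix e e (Matrix.toLin' E) = E := by
    exact LinearMap.toMatrix'_toLin' E
  rw [h1, h2] at h
  exact h.symm

theorem exists_conj_isDiag {m : ℕ} {E : Matrix (Fin m) (Fin m) ℂ} (hE : E * E = 1) :
    ∃ (U : GL (Fin m) ℂ) (E' : Matrix (Fin m) (Fin m) ℂ),
      E = U * E' * (U⁻¹ : GL (Fin m) ℂ) ∧ E'.IsDiag := by
  let f := Matrix.toLin' E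
  have hf : ∀ v, f (f v) = v := fun v => by simp [f, hE]
  have hcompl : IsCompl (LinearMap.ker (f - 1)) (LinearMap.ker (f + 1)) := by
    constructor
    · rw [Submodule.disjoint_def]
      intro v h1 h2
      have h1 : f v - v = 0 := h1
      have h2 : f v + v = 0 := h2
      have : (2 : ℂ) • v = 0 := by
        rw [two_smul, ← sub_eq_zero.mpr (h2.trans h1.symm)]
        abel
      exact (smul_eq_zero.mp this).resolve_left two_ne_zero
    · rw [codisjoint_iff, eq_top_iff]
      intro v _
      refine Submodule.mem_sup.mpr ⟨(1 / 2 : ℂ) • (v + f v), ?_, (1 / 2 : ℂ) • (v - f v), ?_, ?_⟩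
      · simp [hf, add_comm]
      · simp [hf]
      · rw [← smul_add, add_add_sub_cancel, ← two_smul ℂ v, smul_smul]
        norm_num
  obtain ⟨b, first, h1, h2, -, -⟩ := exists_adapted_basis id Function.injective_id hcompl
  obtain ⟨U, hU⟩ := exists_conj_of_basis E b
  refine ⟨U, _, hU, fun i j hij => ?_⟩
  beta_reduce
  by_cases hj : first j
  · have : E *ᵥ b j - b j = 0 := h1 j hj
    rw [Matrix.of_apply, sub_eq_zero.mp this]
    simp [hij.symm]
  · have : E *ᵥ b j + b j = 0 := h2 j hj
    rw [Matrix.of_apply, eq_neg_of_add_eq_zero_left this]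
    simp [hij.symm]

/-- The image of `E` lies in its kernel. With kernel vectors placed first, nonzero entries have a
kernel row and a complement column. A general `p` accommodates the interleaving of the two kinds of
indices. -/
theorem exists_conj_triangular {m n : ℕ} (p : Fin m → Fin n) (hp : Function.Injective p)
    {E : Matrix (Fin m) (Fin m) ℂ} (hE : E * E = 0) :
    ∃ (U : GL (Fin m) ℂ) (E' : Matrix (Fin m) (Fin m) ℂ),
      E = U * E' * (U⁻¹ : GL (Fin m) ℂ) ∧ ∀ i j, E' i j ≠ 0 → p i < p j := by
  obtain ⟨T, hT⟩ := Submodule.exists_isCompl (LinearMap.ker (Matrix.toLin' E))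
  obtain ⟨b, first, h1, -, h3, h4⟩ := exists_adapted_basis p hp hT
  obtain ⟨U, hU⟩ := exists_conj_of_basis E b
  refine ⟨U, _, hU, fun i j hij => h4 i j ?_ fun hj => ?_⟩
  · by_contra hi
    exact hij (h3 _ (by simp [hE]) i hi)
  · have : E *ᵥ b j = 0 := h1 j hj
    simp [this] at hij

variable {M N : ℕ} {θ : ℤˣ}

theorem parity_inl_ne_inr (i : Fin M) (j : Fin N) :
    parity θ (Sum.inl i : Idx M N) ≠ parity θ (Sum.inr j : Idx M N) := by
  simp only [parity]
  split_ifs <;> simp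

theorem isBosonic_iff {A : Matrix (Idx M N) (Idx M N) ℂ} :
    IsBosonic θ A ↔ ∃ A₁ A₂, A = fromBlocks A₁ 0 0 A₂ := by
  constructor
  · intro h
    refine ⟨A.toBlocks₁₁, A.toBlocks₂₂, ?_⟩
    ext (i | i) (j | j)
    · simp [toBlocks₁₁]
    · by_contra hne
      exact parity_inl_ne_inr i j (h _ _ hne)
    · by_contra hne
      exact (parity_inl_ne_inr j i).symm (h _ _ hne)
    · simp [toBlocks₂₂]
  · rintro ⟨A₁, A₂, rfl⟩ (i | i) (j | j) h
    · rfl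
    · simp at h
    · simp at h
    · rfl

theorem IsBosonic.mul {A B : Matrix (Idx M N) (Idx M N) ℂ} (hA : IsBosonic θ A)
    (hB : IsBosonic θ B) : IsBosonic θ (A * B) := by
  obtain ⟨A₁, A₂, rfl⟩ := isBosonic_iff.mp hA
  obtain ⟨B₁, B₂, rfl⟩ := isBosonic_iff.mp hB
  exact isBosonic_iff.mpr ⟨A₁ * B₁, A₂ * B₂, by simp [fromBlocks_multiply]⟩

theorem IsBosonic.add {A B : Matrix (Idx M N) (Idx M N) ℂ} (hA : IsBosonic θ A)
    (hB : IsBosonic θ B) : IsBosonic θ (A + B) := by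
  obtain ⟨A₁, A₂, rfl⟩ := isBosonic_iff.mp hA
  obtain ⟨B₁, B₂, rfl⟩ := isBosonic_iff.mp hB
  exact isBosonic_iff.mpr ⟨A₁ + B₁, A₂ + B₂, by simp [fromBlocks_add]⟩

theorem IsBosonic.smul {A : Matrix (Idx M N) (Idx M N) ℂ} (hA : IsBosonic θ A) (c : ℂ) :
    IsBosonic θ (c • A) := by
  obtain ⟨A₁, A₂, rfl⟩ := isBosonic_iff.mp hA
  exact isBosonic_iff.mpr ⟨c • A₁, c • A₂, by simp [fromBlocks_smul]⟩

theorem isBosonic_one : IsBosonic θ (1 : Matrix (Idx M N) (Idx M N) ℂ) :=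
  isBosonic_iff.mpr ⟨1, 1, fromBlocks_one.symm⟩

theorem isBosonic_blockGL (U : GL (Fin M) ℂ × GL (Fin N) ℂ) : IsBosonic θ (blockGL U) :=
  isBosonic_iff.mpr ⟨_, _, rfl⟩

theorem blockGL_mul_blockGL_inv (U : GL (Fin M) ℂ × GL (Fin N) ℂ) :
    blockGL U * blockGL U⁻¹ = 1 := by
  simp [blockGL, fromBlocks_multiply, -coe_units_inv]

theorem blockGL_inv (U : GL (Fin M) ℂ × GL (Fin N) ℂ) : (blockGL U)⁻¹ = blockGL U⁻¹ :=
  Matrix.inv_eq_right_inv (blockGL_mul_blockGL_inv U)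

theorem blockGL_inv_mul_blockGL (U : GL (Fin M) ℂ × GL (Fin N) ℂ) :
    blockGL U⁻¹ * blockGL U = 1 :=
  mul_eq_one_comm.mp (blockGL_mul_blockGL_inv U)

theorem conj_mul_conj (U : GL (Fin M) ℂ × GL (Fin N) ℂ) (A B : Matrix (Idx M N) (Idx M N) ℂ) :
    (blockGL U * A * blockGL U⁻¹) * (blockGL U * B * blockGL U⁻¹) =
      blockGL U * (A * B) * blockGL U⁻¹ := by
  calc _ = blockGL U * A * (blockGL U⁻¹ * blockGL U) * B * blockGL U⁻¹ := by noncomm_ring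
    _ = _ := by rw [blockGL_inv_mul_blockGL]; noncomm_ring

theorem canonicalK_eq (U : GL (Fin M) ℂ × GL (Fin N) ℂ) (ξ : ℂ)
    (E : Matrix (Idx M N) (Idx M N) ℂ) (z : ℂ) :
    canonicalK U ξ E z = (Complex.I * ξ) • 1 + z • (blockGL U * E * blockGL U⁻¹) := by
  rw [canonicalK, blockGL_inv, mul_add, add_mul, mul_smul_comm, smul_mul_assoc, mul_one,
    blockGL_mul_blockGL_inv, mul_smul_comm, smul_mul_assoc]

theorem exists_isCanonical_conj (pos : Idx M N ≃ Fin (M + N)) {E : Matrix (Idx M N) (Idx M N) ℂ}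
    (hE : IsBosonic θ E) (hsq : E ^ 2 = 0 ∨ E ^ 2 = 1) :
    ∃ (U : GL (Fin M) ℂ × GL (Fin N) ℂ) (E' : Matrix (Idx M N) (Idx M N) ℂ),
      IsCanonical θ pos E' ∧ E = blockGL U * E' * blockGL U⁻¹ := by
  have hback : ∀ (U : GL (Fin M) ℂ × GL (Fin N) ℂ) (E' : Matrix (Idx M N) (Idx M N) ℂ),
      E = blockGL U * E' * blockGL U⁻¹ → E' ^ 2 = blockGL U⁻¹ * E ^ 2 * blockGL U := by
    intro U E' h
    rw [h, pow_two, pow_two, conj_mul_conj]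
    calc E' * E' = (blockGL U⁻¹ * blockGL U) * (E' * E') * (blockGL U⁻¹ * blockGL U) := by
          rw [blockGL_inv_mul_blockGL, one_mul, mul_one]
      _ = _ := by noncomm_ring
  obtain ⟨E₁, E₂, hblocks⟩ := isBosonic_iff.mp hE
  rcases hsq with h0 | h1
  · have h := h0
    rw [hblocks, pow_two, fromBlocks_multiply, ← fromBlocks_zero, fromBlocks_inj] at h
    obtain ⟨U₁, F₁, hF₁, ht₁⟩ := exists_conj_triangular (fun i => pos (Sum.inl i))
      (pos.injective.comp Sum.inl_injective) (E := E₁) (by simpa using h.1)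
    obtain ⟨U₂, F₂, hF₂, ht₂⟩ := exists_conj_triangular (fun i => pos (Sum.inr i))
      (pos.injective.comp Sum.inr_injective) (E := E₂) (by simpa using h.2.2.2)
    have hconj : E = blockGL (U₁, U₂) * fromBlocks F₁ 0 0 F₂ * blockGL (U₁, U₂)⁻¹ := by
      rw [hblocks, hF₁, hF₂]
      simp [blockGL, fromBlocks_multiply]
    refine ⟨(U₁, U₂), _, ⟨isBosonic_iff.mpr ⟨F₁, F₂, rfl⟩, Or.inr ⟨?_, ?_⟩⟩, hconj⟩
    · rintro (i | i) (j | j) hij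
      · exact ht₁ i j hij
      · simp at hij
      · simp at hij
      · exact ht₂ i j hij
    · rw [hback _ _ hconj, h0, mul_zero, zero_mul]
  · have h := h1
    rw [hblocks, pow_two, fromBlocks_multiply, ← fromBlocks_one, fromBlocks_inj] at h
    obtain ⟨U₁, F₁, hF₁, hd₁⟩ := exists_conj_isDiag (E := E₁) (by simpa using h.1)
    obtain ⟨U₂, F₂, hF₂, hd₂⟩ := exists_conj_isDiag (E := E₂) (by simpa using h.2.2.2)
    have hconj : E = blockGL (U₁, U₂) * fromBlocks F₁ 0 0 F₂ * blockGL (U₁, U₂)⁻¹ := by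
      rw [hblocks, hF₁, hF₂]
      simp [blockGL, fromBlocks_multiply]
    refine ⟨(U₁, U₂), _, ⟨isBosonic_iff.mpr ⟨F₁, F₂, rfl⟩, Or.inl ⟨hd₁.fromBlocks hd₂, ?_⟩⟩,
      hconj⟩
    rw [hback _ _ hconj, h1, mul_one, blockGL_inv_mul_blockGL]

/-- In `A B` the coefficient of `E` is proportional to `c (x + y)`, so the second term of the
relation cancels the antisymmetric part `B ⊗ A - A ⊗ B`. -/
theorem tensorRelation_linear {ι : Type*} [Fintype ι] [DecidableEq ι] {E : Matrix ι ι ℂ}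
    {ε : ℂ} (hE : E * E = ε • 1) (c x y s t : ℂ) :
    TensorRelation x y (s • (c • 1 + x • E)) (t • (c • 1 + y • E)) := by
  have hmul : ∀ x y s t : ℂ, (s • (c • 1 + x • E)) * (t • (c • 1 + y • E)) =
      (s * t) • ((c ^ 2 + x * y * ε) • 1 + (c * (x + y)) • E) := by
    intro x y s t
    simp only [smul_mul_assoc, mul_smul_comm, add_mul, mul_add, one_mul, mul_one, hE]
    module
  refine ⟨?_, ?_⟩
  · rw [hmul, hmul]
    module
  · rw [hmul]
    ext ⟨i, k⟩ ⟨j, l⟩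
    simp only [Matrix.add_apply, Matrix.sub_apply, Matrix.smul_apply, kroneckerMap_apply,
      smul_eq_mul, Matrix.zero_apply]
    ring

end CanonicalForm

end SuperReflection

theorem proposition2 (M N : ℕ) (θ : ℤˣ)
    (pos : SuperReflection.Idx M N ≃ Fin (M + N)) :
    (∀ (D : Set ℂ)
        (K : ℂ → Matrix (SuperReflection.Idx M N) (SuperReflection.Idx M N) ℂ),
      (∀ z ∈ D, SuperReflection.IsBosonic θ (K z)) →
      {z ∈ D | IsUnit (K z)}.Infinite →
      SuperReflection.ReflectionEquation θ D K →
      ∃ (U : GL (Fin M) ℂ × GL (Fin N) ℂ) (ξ : ℂ)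
        (E : Matrix (SuperReflection.Idx M N) (SuperReflection.Idx M N) ℂ) (f : ℂ → ℂ),
        SuperReflection.IsCanonical θ pos E ∧
        ∀ z ∈ D, (z ≠ 0 ∨ ξ ≠ 0) → K z = f z • SuperReflection.canonicalK U ξ E z) ∧
    (∀ (U : GL (Fin M) ℂ × GL (Fin N) ℂ) (ξ : ℂ)
        (E : Matrix (SuperReflection.Idx M N) (SuperReflection.Idx M N) ℂ) (f : ℂ → ℂ),
      SuperReflection.IsCanonical θ pos E →
      (∀ z, SuperReflection.IsBosonic θ (f z • SuperReflection.canonicalK U ξ E z)) ∧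
      SuperReflection.ReflectionEquation θ Set.univ
        (fun z => f z • SuperReflection.canonicalK U ξ E z)) := by
  open SuperReflection in
  refine ⟨fun D K hK hinf hrefl => ?_, fun U ξ E f hE => ?_⟩
  · obtain ⟨c, E, f, hsq, ⟨w, hw, r, s, hrs⟩, hf⟩ := exists_linear_form hinf fun x hx y hy =>
      tensorRelation_of_reflection (hK x hx) (hK y hy) (congrArg K) (hrefl x hx y hy)
        (hrefl y hy x hx)
    have hE : IsBosonic θ E := by
      rw [hrs]
      exact (isBosonic_one.smul r).add ((hK w hw).smul s)
    obtain ⟨U, E', hcan, hconj⟩ := exists_isCanonical_conj pos hE hsq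
    -- `ξ = -i c`, so that `i ξ = c`.
    refine ⟨U, -Complex.I * c, E', f, hcan, fun z hz hzc => ?_⟩
    have hI : Complex.I * (-Complex.I * c) = c := by
      rw [← mul_assoc, mul_neg, Complex.I_mul_I, neg_neg, one_mul]
    rw [canonicalK_eq, ← hconj, hI]
    refine hf z hz (hzc.imp_right fun h hc => h ?_)
    rw [hc, mul_zero]
  · have hbos : ∀ z, IsBosonic θ (f z • canonicalK U ξ E z) := by
      intro z
      rw [canonicalK_eq]
      exact ((isBosonic_one.smul _).add
        ((((isBosonic_blockGL U).mul hE.1).mul (isBosonic_blockGL U⁻¹)).smul z)).smul _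
    refine ⟨hbos, fun x _ y _ => reflection_of_tensorRelation (hbos x) (hbos y) ?_⟩
    obtain ⟨ε, hε⟩ : ∃ ε : ℂ, E * E = ε • 1 := by
      rcases hE.2 with h | h
      · exact ⟨1, by rw [← pow_two, h.2, one_smul]⟩
      · exact ⟨0, by rw [← pow_two, h.2, zero_smul]⟩
    beta_reduce
    rw [canonicalK_eq, canonicalK_eq]
    refine tensorRelation_linear (ε := ε) ?_ _ x y (f x) (f y)
    rw [conj_mul_conj, hε, mul_smul_comm, smul_mul_assoc, mul_one, blockGL_mul_blockGL_inv]
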